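/- Let $r\ge 3$ be an odd integer. An $r$-graph $\mathcal H$ is a finite $r$-uniform hypergraph (a finite vertex set $V(\mathcal H)$ together with a set $E(\mathcal H)$ of $r$-element subsets of it). An $r$-kernel is a bounded measurable symmetric function $W:[0,1]^r\to\mathbb R$, and $$t_{\mathcal H}(W)=\int_{[0,1]^{V(\mathcal H)}}\ \prod_{\{i_1,\dots,i_r\}\in E(\mathcal H)} W(x_{i_1},\dots,x_{i_r})\,d\mu^{V(\mathcal H)},$$ where $\mu$ is Lebesgue measure on $[0,1]$. The $r$-graph $\mathcal H$ is called positive if $t_{\mathcal H}(W)\ge 0$ for every $r$-kernel $W$. It is called connected if it has at least one vertex and any two distinct vertices $u,v$ are joined by a sequence $u=v_0,v_1,\dots,v_m=v$ of vertices such that, for each $j$, some edge contains both $v_{j-1}$ and $v_j$. (i) If $\mathcal H$ is a connected $r$-graph in which every vertex has odd degree (lies in an odd number of edges), then $\mathcal H$ is not positive. (ii) In particular, for every $\ell\ge r$, the $r$-uniform tight cycle $\mathcal C_\ell^{(r)}$, with vertex set $\{1,\dots,\ell\}$ and edges the sets $\{i,i+1,\dots,i+r-1\}$ for $i=1,\dots,\ell$,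 with addition modulo $\ell$, is not positive. -/

import Mathlib

open MeasureTheory

/-- An `r`-graph on the vertex set `V`: a set of edges, each of them an `r`-element subset of `V`
(no repeated edges). The vertex set is the whole type `V`, which is finite wherever it matters. -/
structure UniformHypergraph (r : ℕ) (V : Type*) where
  edges : Finset (Finset V)
  card_of_mem : ∀ e ∈ edges, e.card = r

/-- An `r`-kernel: a bounded measurable symmetric function `[0,1]^r → ℝ`. -/
structure RKernel (r : ℕ) where
  toFun : (Fin r → unitInterval) → ℝ
  measurable' : Measurable toFun
  bounded' : ∃ C : ℝ, ∀ x, |toFun x| ≤ C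
  symm' : ∀ (σ : Equiv.Perm (Fin r)) (x : Fin r → unitInterval), toFun (x ∘ σ) = toFun x

namespace UniformHypergraph

variable {r : ℕ} {V : Type*}

/-- The degree of a vertex: the number of edges that contain it. -/
def degree [DecidableEq V] (H : UniformHypergraph r V) (v : V) : ℕ :=
  (H.edges.filter (fun e => v ∈ e)).card

/-- Two distinct vertices are adjacent in the shadow graph when some edge contains both. -/
def shadow (H : UniformHypergraph r V) : SimpleGraph V where
  Adj u v := u ≠ v ∧ ∃ e ∈ H.edges, u ∈ e ∧ v ∈ e
  symm := ⟨fun _ _ h => ⟨h.1.symm, h.2.imp fun _ he => ⟨he.1, he.2.2, he.2.1⟩⟩⟩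
  loopless := ⟨fun _ h => h.1 rfl⟩

/-- A hypergraph is connected if it has a vertex and any two vertices are linked by a chain of
edges in which consecutive edges meet. -/
def Connected (H : UniformHypergraph r V) : Prop := H.shadow.Connected

/-- An enumeration of the vertices of an edge. Kernels are symmetric, so the choice is immaterial
(see `RKernel.eval_eq`). -/
noncomputable def enum (H : UniformHypergraph r V) (e : H.edges) : Fin r ≃ (e : Finset V) :=
  ((e : Finset V).equivFinOfCardEq (H.card_of_mem e e.2)).symm

/-- The homomorphism density
`t_H(W) = ∫_{[0,1]^V} ∏_{i₁⋯iᵣ ∈ E(H)} W(x_{i₁}, …, x_{iᵣ}) dx`, with respect to Lebesgue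
measure. -/
noncomputable def density [Fintype V] (H : UniformHypergraph r V) (W : RKernel r) : ℝ :=
  ∫ x : V → unitInterval, ∏ e : H.edges, W.toFun (fun k => x (H.enum e k))

/-- `H` is positive if `t_H(W) ≥ 0` for all `r`-kernels `W`. -/
def Positive [Fintype V] (H : UniformHypergraph r V) : Prop :=
  ∀ W : RKernel r, 0 ≤ H.density W

end UniformHypergraph

/-- The value of a kernel on an `r`-set of points does not depend on how the set is enumerated. -/
theorem RKernel.eval_eq {r : ℕ} {V : Type*} (W : RKernel r) (e : Finset V) (x : V → unitInterval)
    (f g : Fin r ≃ e) : W.toFun (fun k => x (f k)) = W.toFun (fun k => x (g k)) := by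
  have h := W.symm' (f.trans g.symm) (fun k => x (g k))
  rw [← h]
  congr 1
  funext k
  simp

/-- The edge `{i, i+1, …, i+r-1}` of a tight cycle, with addition modulo `ℓ`. -/
def tightEdge (r : ℕ) {ℓ : ℕ} (i : Fin ℓ) : Finset (Fin ℓ) :=
  (Finset.range r).image (fun j => (⟨(i.1 + j) % ℓ, Nat.mod_lt _ i.pos⟩ : Fin ℓ))

theorem card_tightEdge {r ℓ : ℕ} (h : r ≤ ℓ) (i : Fin ℓ) : (tightEdge r i).card = r := by
  unfold tightEdge
  rw [Finset.card_image_of_injOn, Finset.card_range]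
  intro a ha b hb hab
  simp only [Finset.coe_range, Set.mem_Iio] at ha hb
  have h1 : (i.1 + a) ≡ (i.1 + b) [MOD ℓ] := congrArg Fin.val hab
  have h2 := Nat.ModEq.add_left_cancel' _ h1
  exact Nat.ModEq.eq_of_lt_of_lt h2 (by omega) (by omega)

/-- The `r`-uniform tight cycle on `ℓ ≥ r` vertices. -/
def tightCycle (r ℓ : ℕ) (h : r ≤ ℓ) : UniformHypergraph r (Fin ℓ) where
  edges := Finset.univ.image (fun i : Fin ℓ => tightEdge r i)
  card_of_mem := by
    intro e he
    obtain ⟨i, -, rfl⟩ := Finset.mem_image.1 he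
    exact card_tightEdge h i

/-!
The proof builds, for a connected `r`-graph `H` with all degrees odd, a kernel with negative
density. It is a step function with values in `{-1, 0, 1}`, whose steps are indexed by the pairs
`(u, b)` of a vertex `u` of `H` and a sign vector `b` on the edges. On `(u₁, b₁), …, (uᵣ, bᵣ)` it
vanishes unless `f = {u₁, …, uᵣ}` is an edge of `H`; in that case it is
`ε f * ∏ k, (b k f * ∏ f' ∋ u k, b k f')`, where `ε` is `-1` at one chosen edge and `1` elsewhere.

Expanding the density gives a sum over the maps `φ : V → V` that send edges to edges
(`sum_prod_colourKernel`). The sign vectors are summed independently at each vertex, so the term of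
`φ` is `∏ e, ε (φ e)` times a product over the vertices `v` of character sums. Such a character sum
is nonnegative, and because the degree of `v` is odd it vanishes as soon as some edge at `φ v` is
not the image of an edge at `v` (`exists_edge_of_localFactor_ne_zero`). If no factor vanishes, the
range of `φ` is therefore closed under adjacency, hence is everything by connectedness, so that `φ`
is bijective and permutes the edges. Its sign `∏ e, ε (φ e)` is then `∏ e, ε e = -1`. Every term is
thus nonpositive, and the one of the identity is negative.

Tight cycles are connected, and their degrees are `r` if `r < ℓ` and `1` if `r = ℓ`.
-/

/-! ### Step kernels -/

/-- The density of a kernel that factors through a map pushing Lebesgue measure forward to the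
uniform measure on a finite set is a normalised sum over all colourings. -/
theorem UniformHypergraph.density_eq_sum {r : ℕ} {V S : Type*} [Fintype V] [DecidableEq V]
    [Fintype S] [Nonempty S] [MeasurableSpace S] [MeasurableSingletonClass S]
    (H : UniformHypergraph r V) (W : RKernel r)
    (p : unitInterval → S) (hp : Measurable p)
    (hmap : (volume : Measure unitInterval).map p = ProbabilityTheory.uniformOn Set.univ)
    (w : (Fin r → S) → ℝ) (hW : ∀ x, W.toFun x = w (fun k => p (x k))) :
    H.density W = ((Fintype.card S : ℝ)⁻¹) ^ Fintype.card V *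
      ∑ s : V → S, ∏ e : H.edges, w (fun k => s (H.enum e k)) := by
  have hmp : MeasurePreserving p volume (ProbabilityTheory.uniformOn (Set.univ : Set S)) :=
    ⟨hp, hmap⟩
  have hpi := measurePreserving_pi (fun _ : V => (volume : Measure unitInterval))
    (fun _ : V => ProbabilityTheory.uniformOn (Set.univ : Set S)) (fun _ => hmp)
  unfold UniformHypergraph.density
  simp only [hW]
  have h1 := integral_map (μ := (volume : Measure (V → unitInterval)))
    (φ := fun (x : V → unitInterval) (i : V) => p (x i)) hpi.measurable.aemeasurable
    (f := fun s : V → S => ∏ e : H.edges, w (fun k => s (H.enum e k)))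
    (measurable_of_finite _).aestronglyMeasurable
  have h2 : (volume : Measure (V → unitInterval)).map
      (fun (x : V → unitInterval) (i : V) => p (x i)) =
      Measure.pi (fun _ : V => ProbabilityTheory.uniformOn (Set.univ : Set S)) := hpi.map_eq
  rw [← h1, h2, integral_fintype Integrable.of_finite, Finset.mul_sum]
  refine Finset.sum_congr rfl fun s _ => ?_
  rw [smul_eq_mul]
  congr 1
  simp [Measure.real, Measure.pi_singleton, ProbabilityTheory.uniformOn_univ]

namespace UniformHypergraph

variable {r : ℕ} {V : Type*} [DecidableEq V]

/-- The real sign `±1` encoded by a Boolean. -/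
def boolSign (x : Bool) : ℝ := if x then 1 else -1

/-- The sign attached to an edge `f` and a colour `(u, b)`, namely `b f * ∏ f' ∋ u, b f'`. Sign
vectors are indexed by all finsets of vertices; only their values at edges are used. -/
def charge (H : UniformHypergraph r V) (f : Finset V) (s : V × (Finset V → Bool)) : ℝ :=
  boolSign (s.2 f) * ∏ f' ∈ H.edges.filter (fun f' => s.1 ∈ f'), boolSign (s.2 f')

/-- The symmetric function on `r`-tuples of colours from which the negative-density kernel is
made. A tuple with a repeated first coordinate spans fewer than `r` vertices, hence no edge. -/
def colourKernel (H : UniformHypergraph r V) (ε : Finset V → ℝ)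
    (s : Fin r → V × (Finset V → Bool)) : ℝ :=
  if Finset.univ.image (fun k => (s k).1) ∈ H.edges then
    ε (Finset.univ.image (fun k => (s k).1)) *
      ∏ k, H.charge (Finset.univ.image (fun k => (s k).1)) (s k)
  else 0

theorem colourKernel_comp_perm (H : UniformHypergraph r V) (ε : Finset V → ℝ)
    (σ : Equiv.Perm (Fin r)) (s : Fin r → V × (Finset V → Bool)) :
    H.colourKernel ε (s ∘ σ) = H.colourKernel ε s := by
  have h : Finset.univ.image (fun k => ((s ∘ σ) k).1) = Finset.univ.image (fun k => (s k).1) := by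
    ext v
    simp only [Finset.mem_image, Finset.mem_univ, true_and, Function.comp_apply]
    exact σ.surjective.exists (p := fun k => (s k).1 = v) |>.symm
  unfold colourKernel
  rw [h]
  congr 2
  exact Equiv.prod_comp σ (fun k => H.charge (Finset.univ.image (fun k => (s k).1)) (s k))

theorem colourKernel_enum (H : UniformHypergraph r V) (ε : Finset V → ℝ) (e : H.edges)
    (s : V → V × (Finset V → Bool)) :
    H.colourKernel ε (fun k => s (H.enum e k)) =
      if (e : Finset V).image (fun v => (s v).1) ∈ H.edges then
        ε ((e : Finset V).image (fun v => (s v).1)) *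
          ∏ v ∈ (e : Finset V), H.charge ((e : Finset V).image (fun v => (s v).1)) (s v)
      else 0 := by
  have h : Finset.univ.image (fun k => (s (H.enum e k)).1) =
      (e : Finset V).image (fun v => (s v).1) := by
    ext u
    simp only [Finset.mem_image, Finset.mem_univ, true_and]
    rw [(H.enum e).surjective.exists.symm.trans
      (Iff.rfl : (∃ v : (e : Finset V), (s v).1 = u) ↔ _)]
    simp
  unfold colourKernel
  simp only [h]
  congr 2
  rw [(H.enum e).prod_comp
    (fun v => H.charge ((e : Finset V).image (fun v => (s v).1)) (s v))]
  exact Finset.prod_coe_sort (e : Finset V)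
    (fun v => H.charge ((e : Finset V).image (fun v => (s v).1)) (s v))

/-! ### Character sums at a vertex -/

variable [Fintype V]

/-- The contribution of the vertex `v` to the term of the vertex map `φ` in the density of the
colour kernel. -/
def localFactor (H : UniformHypergraph r V) (φ : V → V) (v : V) : ℝ :=
  ∑ b : Finset V → Bool, ∏ e ∈ H.edges.filter (fun e => v ∈ e), H.charge (e.image φ) (φ v, b)

/-- The sum over sign vectors factors over their coordinates `b f`. The exponent of `b f` counts the
edges at `v` with image `f`, and once more each edge at `v` if `f` is an edge at `φ v`. -/
theorem localFactor_eq_prod (H : UniformHypergraph r V) (φ : V → V) (v : V) :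
    H.localFactor φ v = ∏ f : Finset V,
      (1 + (-1 : ℝ) ^ (((H.edges.filter (fun e => v ∈ e)).filter (fun e => e.image φ = f)).card +
        H.degree v * if f ∈ H.edges ∧ φ v ∈ f then 1 else 0)) := by
  have key : ∀ b : Finset V → Bool,
      ∏ e ∈ H.edges.filter (fun e => v ∈ e), H.charge (e.image φ) (φ v, b) =
      ∏ f : Finset V, boolSign (b f) ^
        (((H.edges.filter (fun e => v ∈ e)).filter (fun e => e.image φ = f)).card +
          H.degree v * if f ∈ H.edges ∧ φ v ∈ f then 1 else 0) := by
    intro b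
    simp only [charge, Finset.prod_mul_distrib, pow_add, Finset.prod_const]
    congr 1
    · rw [← Finset.prod_fiberwise (H.edges.filter (fun e => v ∈ e)) (fun e => e.image φ)
        (fun e => boolSign (b (e.image φ)))]
      refine Finset.prod_congr rfl fun f _ => ?_
      rw [Finset.prod_congr rfl (g := fun _ => boolSign (b f)), Finset.prod_const]
      intro e he
      rw [(Finset.mem_filter.1 he).2]
    · rw [← Finset.prod_pow]
      symm
      rw [← Finset.prod_subset (Finset.subset_univ (H.edges.filter (fun f => φ v ∈ f)))]
      · refine Finset.prod_congr rfl fun f hf => ?_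
        rw [if_pos (Finset.mem_filter.1 hf), mul_one]
        rfl
      · intro f _ hf
        rw [if_neg (fun h => hf (Finset.mem_filter.2 h)), mul_zero, pow_zero]
  unfold localFactor
  simp only [key]
  rw [← Fintype.piFinset_univ, ← Finset.prod_univ_sum
    (fun _ : Finset V => (Finset.univ : Finset Bool))
    (fun f x => boolSign x ^
        (((H.edges.filter (fun e => v ∈ e)).filter (fun e => e.image φ = f)).card +
          H.degree v * if f ∈ H.edges ∧ φ v ∈ f then 1 else 0))]
  refine Finset.prod_congr rfl fun f _ => ?_
  simp [boolSign]

theorem localFactor_nonneg (H : UniformHypergraph r V) (φ : V → V) (v : V) :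
    0 ≤ H.localFactor φ v := by
  rw [localFactor_eq_prod]
  refine Finset.prod_nonneg fun f _ => ?_
  rcases neg_one_pow_eq_or ℝ (((H.edges.filter (fun e => v ∈ e)).filter
    (fun e => e.image φ = f)).card + H.degree v * if f ∈ H.edges ∧ φ v ∈ f then 1 else 0) with h | h
    <;> rw [h] <;> norm_num

theorem localFactor_id_pos (H : UniformHypergraph r V) {v : V} (hv : Odd (H.degree v)) :
    0 < H.localFactor id v := by
  rw [localFactor_eq_prod]
  refine Finset.prod_pos fun f _ => ?_
  simp only [Finset.image_id, id]
  rw [Even.neg_one_pow]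
  · norm_num
  rw [Finset.filter_eq']
  by_cases hf : f ∈ H.edges ∧ v ∈ f
  · rw [if_pos (Finset.mem_filter.2 hf), if_pos hf, Finset.card_singleton, mul_one]
    exact odd_one.add_odd hv
  · rw [if_neg (fun h => hf (Finset.mem_filter.1 h)), if_neg hf]
    simp

/-- Where the oddness of the degrees enters: the exponent of `f` in `localFactor_eq_prod` is the odd
number `H.degree v` if `f` is an edge at `φ v` that is not covered by an edge at `v`. -/
theorem exists_edge_of_localFactor_ne_zero (H : UniformHypergraph r V) {φ : V → V} {v : V}
    (hv : Odd (H.degree v)) (h : H.localFactor φ v ≠ 0) {f : Finset V} (hf : f ∈ H.edges)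
    (hvf : φ v ∈ f) : ∃ e ∈ H.edges, v ∈ e ∧ e.image φ = f := by
  by_contra! hne
  apply h
  rw [localFactor_eq_prod]
  refine Finset.prod_eq_zero (Finset.mem_univ f) ?_
  rw [Finset.filter_eq_empty_iff.2, if_pos ⟨hf, hvf⟩, Finset.card_empty, zero_add, mul_one,
    hv.neg_one_pow]
  · norm_num
  · intro e he
    exact hne e (Finset.mem_filter.1 he).1 (Finset.mem_filter.1 he).2

/-! ### Locally surjective vertex maps -/

/-- A vertex map under which every edge at `φ v` is the image of an edge at `v` has a range that is
closed under adjacency. -/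
theorem bijective_of_locally_surjective (H : UniformHypergraph r V) (hH : H.Connected) {φ : V → V}
    (hφ : ∀ v, ∀ f ∈ H.edges, φ v ∈ f → ∃ e ∈ H.edges, v ∈ e ∧ e.image φ = f) :
    Function.Bijective φ := by
  refine Finite.surjective_iff_bijective.1 fun u => ?_
  obtain ⟨v₀⟩ := hH.nonempty
  have hwalk : ∀ {a b : V}, H.shadow.Walk a b → a ∈ Set.range φ → b ∈ Set.range φ := by
    intro a b p
    induction p with
    | nil => exact id
    | cons hab _ ih =>
      rintro ⟨v, rfl⟩
      obtain ⟨-, f, hf, hva, hvb⟩ := hab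
      obtain ⟨e, -, -, rfl⟩ := hφ v f hf hva
      obtain ⟨w, -, hw⟩ := Finset.mem_image.1 hvb
      exact ih ⟨w, hw⟩
  obtain ⟨p⟩ := hH.preconnected (φ v₀) u
  exact hwalk p ⟨v₀, rfl⟩

omit [Fintype V] in
theorem prod_image_eq_prod (H : UniformHypergraph r V) {φ : V → V} (hφ : Function.Injective φ)
    (hE : ∀ e ∈ H.edges, e.image φ ∈ H.edges) (ε : Finset V → ℝ) :
    ∏ e ∈ H.edges, ε (e.image φ) = ∏ e ∈ H.edges, ε e := by
  have hinj : Set.InjOn (fun e : Finset V => e.image φ) (H.edges : Set (Finset V)) :=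
    (Finset.image_injective hφ).injOn
  exact Finset.prod_nbij (fun e => e.image φ) hE hinj
    (Finset.surjOn_of_injOn_of_card_le _ hE hinj le_rfl) (fun _ _ => rfl)

/-! ### The density of the colour kernel -/

/-- The term of the vertex map `φ` in the expansion of the density of the colour kernel. -/
def mapTerm (H : UniformHypergraph r V) (ε : Finset V → ℝ) (φ : V → V) : ℝ :=
  if ∀ e ∈ H.edges, e.image φ ∈ H.edges then
    (∏ e ∈ H.edges, ε (e.image φ)) * ∏ v, H.localFactor φ v
  else 0

theorem sum_prod_colourKernel (H : UniformHypergraph r V) (ε : Finset V → ℝ) :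
    ∑ s : V → V × (Finset V → Bool), ∏ e : H.edges, H.colourKernel ε (fun k => s (H.enum e k)) =
      ∑ φ : V → V, H.mapTerm ε φ := by
  simp only [colourKernel_enum]
  rw [← (Equiv.arrowProdEquivProdArrow V (fun _ => V) (fun _ => Finset V → Bool)).symm.sum_comp,
    Fintype.sum_prod_type]
  refine Finset.sum_congr rfl fun φ _ => ?_
  change ∑ b : V → Finset V → Bool, (∏ e : H.edges, if (e : Finset V).image φ ∈ H.edges then
    ε ((e : Finset V).image φ) *
      ∏ v ∈ (e : Finset V), H.charge ((e : Finset V).image φ) (φ v, b v) else 0) = _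
  unfold mapTerm
  split_ifs with hφ
  · have h : ∀ b : V → Finset V → Bool,
        (∏ e : H.edges, if (e : Finset V).image φ ∈ H.edges then
          ε ((e : Finset V).image φ) *
            ∏ v ∈ (e : Finset V), H.charge ((e : Finset V).image φ) (φ v, b v) else 0) =
        (∏ e ∈ H.edges, ε (e.image φ)) *
          ∏ v, ∏ e ∈ H.edges.filter (fun e => v ∈ e), H.charge (e.image φ) (φ v, b v) := by
      intro b
      rw [Finset.prod_coe_sort H.edges (fun e => if e.image φ ∈ H.edges then
          ε (e.image φ) * ∏ v ∈ e, H.charge (e.image φ) (φ v, b v) else 0),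
        Finset.prod_congr rfl (fun e he => if_pos (hφ e he)), Finset.prod_mul_distrib]
      congr 1
      exact Finset.prod_comm' (by simp [and_comm])
    simp only [h, ← Finset.mul_sum]
    congr 1
    unfold localFactor
    rw [Finset.prod_univ_sum, Fintype.piFinset_univ]
  · push Not at hφ
    obtain ⟨e, he, hne⟩ := hφ
    refine Finset.sum_eq_zero fun b _ => ?_
    exact Finset.prod_eq_zero (Finset.mem_univ (⟨e, he⟩ : H.edges)) (if_neg hne)

theorem mapTerm_nonpos (H : UniformHypergraph r V) (hH : H.Connected)
    (hdeg : ∀ v, Odd (H.degree v)) {ε : Finset V → ℝ} (hε : ∏ e ∈ H.edges, ε e ≤ 0) (φ : V → V) :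
    H.mapTerm ε φ ≤ 0 := by
  unfold mapTerm
  split_ifs with hE
  · by_cases h0 : ∃ v, H.localFactor φ v = 0
    · obtain ⟨v, hv⟩ := h0
      rw [Finset.prod_eq_zero (Finset.mem_univ v) hv, mul_zero]
    · push Not at h0
      have hbij := H.bijective_of_locally_surjective hH
        (fun v f hf hvf => H.exists_edge_of_localFactor_ne_zero (hdeg v) (h0 v) hf hvf)
      rw [H.prod_image_eq_prod hbij.injective hE]
      exact mul_nonpos_of_nonpos_of_nonneg hε
        (Finset.prod_nonneg fun v _ => H.localFactor_nonneg φ v)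
  · exact le_rfl

theorem mapTerm_id_neg (H : UniformHypergraph r V) (hdeg : ∀ v, Odd (H.degree v))
    {ε : Finset V → ℝ} (hε : ∏ e ∈ H.edges, ε e < 0) : H.mapTerm ε id < 0 := by
  unfold mapTerm
  simp only [Finset.image_id, imp_self, implies_true, if_true]
  exact mul_neg_of_neg_of_pos hε (Finset.prod_pos fun v _ => H.localFactor_id_pos (hdeg v))

theorem not_positive_of_odd_degree (H : UniformHypergraph r V) (hH : H.Connected)
    (hdeg : ∀ v, Odd (H.degree v)) : ¬ H.Positive := by
  obtain ⟨v₀⟩ := hH.nonempty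
  obtain ⟨e₀, he₀⟩ : H.edges.Nonempty := by
    obtain ⟨e, he⟩ := Finset.card_pos.1 (hdeg v₀).pos
    exact ⟨e, (Finset.mem_filter.1 he).1⟩
  let ε : Finset V → ℝ := fun f => if f = e₀ then -1 else 1
  have hε : ∏ e ∈ H.edges, ε e = -1 := by
    simp [ε, Finset.prod_ite_eq', he₀]
  let _ : MeasurableSpace (V × (Finset V → Bool)) := ⊤
  have : Nonempty (V × (Finset V → Bool)) := ⟨(v₀, fun _ => true)⟩
  obtain ⟨p, hp, hmap⟩ := Measure.exists_measurable_map_eq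
    (ProbabilityTheory.uniformOn (Set.univ : Set (V × (Finset V → Bool))))
  let W : RKernel r :=
    { toFun := fun x => H.colourKernel ε (fun k => p (x k))
      measurable' := (measurable_of_finite (H.colourKernel ε)).comp
        (measurable_pi_lambda _ fun k => hp.comp (measurable_pi_apply k))
      bounded' := by
        obtain ⟨C, hC⟩ := (Set.finite_range (fun s => |H.colourKernel ε s|)).bddAbove
        exact ⟨C, fun x => hC ⟨fun k => p (x k), rfl⟩⟩
      symm' := fun σ x => H.colourKernel_comp_perm ε σ (fun k => p (x k)) }
  intro hpos
  have h := hpos W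
  rw [H.density_eq_sum W p hp hmap (H.colourKernel ε) (fun _ => rfl), sum_prod_colourKernel] at h
  have hneg : ∑ φ : V → V, H.mapTerm ε φ < 0 :=
    Finset.sum_neg' (fun φ _ => H.mapTerm_nonpos hH hdeg (by rw [hε]; norm_num) φ)
      ⟨id, Finset.mem_univ _, H.mapTerm_id_neg hdeg (by rw [hε]; norm_num)⟩
  have hcard : (0 : ℝ) < ((Fintype.card (V × (Finset V → Bool)) : ℝ)⁻¹) ^ Fintype.card V :=
    pow_pos (inv_pos.2 (Nat.cast_pos.2 Fintype.card_pos)) _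
  exact absurd h (not_le.2 (mul_neg_of_pos_of_neg hcard hneg))

end UniformHypergraph

/-! ### Tight cycles -/

theorem mem_tightEdge {r ℓ : ℕ} (h : r ≤ ℓ) {i v : Fin ℓ} : v ∈ tightEdge r i ↔ (v - i).1 < r := by
  have hv := v.2
  have hi := i.2
  simp only [tightEdge, Finset.mem_image, Finset.mem_range, Fin.sub_def, Fin.ext_iff]
  constructor
  · rintro ⟨j, hj, hjv⟩
    have : (ℓ - i.1 + v.1) % ℓ = j := by
      rw [← hjv, Nat.add_mod_mod, show ℓ - i.1 + (i.1 + j) = j + ℓ by omega, Nat.add_mod_right,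
        Nat.mod_eq_of_lt (by omega)]
    omega
  · intro hlt
    refine ⟨_, hlt, ?_⟩
    rw [Nat.add_mod_mod, show i.1 + (ℓ - i.1 + v.1) = v.1 + ℓ by omega, Nat.add_mod_right,
      Nat.mod_eq_of_lt hv]

/-- The first vertex `i` of a tight edge shorter than the cycle is determined by the edge, as the
only one of its vertices whose predecessor is not in the edge. -/
theorem tightEdge_injective {r ℓ : ℕ} (hr : 0 < r) (h : r < ℓ) :
    Function.Injective (tightEdge r : Fin ℓ → Finset (Fin ℓ)) := by
  intro i j hij
  by_contra hne
  have : NeZero ℓ := ⟨by omega⟩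
  have hj : (j - i).1 < r := by
    rw [← mem_tightEdge h.le, hij, mem_tightEdge h.le, sub_self]
    exact hr
  have hpos : (j - i).1 ≠ 0 := fun h0 => hne (sub_eq_zero.1 (Fin.ext h0)).symm
  have hpred : (j - 1 : Fin ℓ) ∈ tightEdge r i := by
    rw [mem_tightEdge h.le, sub_right_comm,
      Fin.val_sub_one_of_ne_zero (fun h0 => hpos (by rw [h0]; rfl))]
    omega
  rw [hij, mem_tightEdge h.le, sub_sub_cancel_left] at hpred
  have : ((-1 : Fin ℓ)).1 = ℓ - 1 := by
    obtain ⟨n, rfl⟩ : ∃ n, ℓ = n + 1 := ⟨ℓ - 1, by omega⟩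
    simp
  omega

theorem tightCycle_degree_odd {r ℓ : ℕ} (hr : 0 < r) (hodd : Odd r) (h : r ≤ ℓ) (v : Fin ℓ) :
    Odd ((tightCycle r ℓ h).degree v) := by
  have : NeZero ℓ := ⟨by omega⟩
  unfold UniformHypergraph.degree tightCycle
  dsimp only
  rcases h.lt_or_eq with hlt | rfl
  · rw [Finset.filter_image, Finset.card_image_of_injective _ (tightEdge_injective hr hlt)]
    have : (Finset.univ.filter (fun i : Fin ℓ => v ∈ tightEdge r i)).card = r := by
      simp only [mem_tightEdge h]
      rw [← Finset.card_map (Equiv.subLeft v).toEmbedding]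
      have h1 : (Finset.univ.filter (fun i : Fin ℓ => (v - i).1 < r)).map
          (Equiv.subLeft v).toEmbedding = Finset.univ.filter (fun j : Fin ℓ => j.1 < r) := by
        ext j
        simp only [Finset.mem_map_equiv, Finset.mem_filter, Finset.mem_univ, true_and]
        simp
      rw [h1, Fin.card_filter_val_lt, min_eq_right h]
    rwa [this]
  · -- For `ℓ = r` all the tight edges coincide with the whole vertex set.
    have huniv : ∀ i : Fin r, tightEdge r i = Finset.univ := fun i =>
      Finset.eq_univ_of_card _ (by rw [card_tightEdge le_rfl, Fintype.card_fin])
    simp only [huniv]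
    rw [Finset.image_const Finset.univ_nonempty, Finset.filter_singleton,
      if_pos (Finset.mem_univ v)]
    simp

theorem tightCycle_connected {r ℓ : ℕ} (hr : 2 ≤ r) (h : r ≤ ℓ) :
    (tightCycle r ℓ h).Connected := by
  obtain ⟨n, rfl⟩ : ∃ n, ℓ = n + 1 := ⟨ℓ - 1, by omega⟩
  have hzero : ∀ i : Fin (n + 1), (tightCycle r (n + 1) h).shadow.Reachable 0 i := by
    intro i
    induction i using Fin.induction with
    | zero => exact SimpleGraph.Reachable.refl _
    | succ i ih =>
      refine ih.trans (SimpleGraph.Adj.reachable ?_)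
      refine ⟨Fin.castSucc_lt_succ.ne, tightEdge r i.castSucc,
        Finset.mem_image_of_mem _ (Finset.mem_univ _), ?_, ?_⟩
      · rw [mem_tightEdge h, sub_self]
        exact lt_of_lt_of_le two_pos hr
      · have hsub : (i.succ - i.castSucc).1 = 1 := by
          rw [Fin.sub_val_of_le Fin.castSucc_lt_succ.le]
          simp
        rw [mem_tightEdge h, hsub]
        omega
  exact (SimpleGraph.connected_iff _).2 ⟨fun a b => (hzero a).symm.trans (hzero b), ⟨0⟩⟩

theorem mainTheorem2 (r : ℕ) (hr : 3 ≤ r) (hodd : Odd r) :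
    (∀ (V : Type*) [Fintype V] [DecidableEq V] (H : UniformHypergraph r V),
      H.Connected → (∀ v : V, Odd (H.degree v)) → ¬ H.Positive) ∧
    (∀ (ℓ : ℕ) (hℓ : r ≤ ℓ), ¬ (tightCycle r ℓ hℓ).Positive) := by
  refine ⟨fun V _ _ H hH hdeg => H.not_positive_of_odd_degree hH hdeg, fun ℓ hℓ => ?_⟩
  exact (tightCycle r ℓ hℓ).not_positive_of_odd_degree (tightCycle_connected (by omega) hℓ)
    (tightCycle_degree_odd (by omega) hodd hℓ)
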